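/- Let $E=H(\mathbb{C})$, or $E=H(D(0,R))$ with $R>0$ and $D(0,R)=\{z\in\mathbb{C}: |z|<R\}$, be the space of holomorphic functions with the topology of uniform convergence on compact sets. Let $T:E\to E$ be a weighted shift with nonzero weights $(w_n)_{n\ge 1}$, i.e. a continuous linear operator with $T(1)=0$ and $T(z^n)=w_n z^{n-1}$ for $n\ge 1$; put $\beta_n=w_1\cdots w_n$ for $n\geq 1$ and $\beta_0=1$. Assume that $T$ is chaotic, i.e. that $T$ has a dense orbit and a dense set of periodic points. Let $X$ be a complex random variable which is subgaussian (there are $C,c>0$ with $\mathbb{P}(|X|\ge t)\le Ce^{-ct^2}$ for all $t\ge 0$) and has full support (every nonempty open subset of $\mathbb{C}$ is hit by $X$ with positive probability), and let $(X_n)_{n\ge 0}$ be i.i.d. copies of $X$. Then the random function $$v=\sum_{n=0}^{\infty}\frac{X_n}{\beta_n}z^n$$ is almost surely well-defined (the series almost surely converges unconditionally in $E$, and $v$ is a random vector in $E$, i.e. measurable up to a null set), and almost surely frequently hypercyclic for $T$: for every nonempty open $V\subset E$ the set $\{n\ge 0: T^n v\in V\}$ has positive lower density. Moreover, the law of $v$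 is an exact measure for $T$ with full support, i.e. a $T$-invariant Borel probability measure on $E$ that is positive on every nonempty open set and for which every set in $\bigcap_{n\ge 0}T^{-n}(\mathcal{B}(E))$ has measure $0$ or $1$, where $\mathcal{B}(E)$ is the Borel $\sigma$-algebra of $E$. In particular, all this holds for every nondegenerate complex Gaussian variable $X$, i.e. one whose real and imaginary parts are jointly Gaussian (with arbitrary mean) and which is not almost surely contained in a real line of $\mathbb{C}$; for a circularly symmetric complex Gaussian (independent real and imaginary parts of equal variance) this means that $X$ is not almost surely constant. -/

import Mathlib

open MeasureTheory ProbabilityTheory Filter TopologicalSpace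
open scoped Topology

/-- The space `H(U)` of holomorphic functions on an open set `U` of the complex plane, as a subspace
of `C(U, ℂ)`. The topology it inherits from the compact-open topology is that of uniform
convergence on the compact subsets of `U`. -/
def HolSpace (U : Opens ℂ) : Submodule ℂ C(U, ℂ) where
  carrier := {f | ∃ g : ℂ → ℂ, DifferentiableOn ℂ g U ∧ ∀ z : U, f z = g z}
  add_mem' := by
    rintro f₁ f₂ ⟨g₁, hd₁, h₁⟩ ⟨g₂, hd₂, h₂⟩
    exact ⟨g₁ + g₂, hd₁.add hd₂, fun z => by simp [h₁ z, h₂ z]⟩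
  zero_mem' := ⟨0, differentiableOn_const 0, fun z => by simp⟩
  smul_mem' := by
    rintro c f ⟨g, hd, h⟩
    exact ⟨c • g, hd.const_smul c, fun z => by simp [h z]⟩

/-- `H(U)` carries its Borel sigma-algebra. -/
noncomputable instance HolSpace.instMeasurableSpace (U : Opens ℂ) : MeasurableSpace (HolSpace U) :=
  borel (HolSpace U)

instance HolSpace.instBorelSpace (U : Opens ℂ) : BorelSpace (HolSpace U) := ⟨rfl⟩

/-- The monomial `z ↦ z ^ n` as an element of `H(U)`. -/
noncomputable def HolSpace.monomial (U : Opens ℂ) (n : ℕ) : HolSpace U :=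
  ⟨⟨fun z => (z : ℂ) ^ n, by fun_prop⟩, fun z => z ^ n, by fun_prop, fun _ => rfl⟩

/-- `T` is the unilateral weighted shift on `H(U)` with weights `w 1, w 2, …`, all nonzero, with
respect to the monomials. The value `w 0` plays no role. -/
structure IsWeightedShift {U : Opens ℂ} (T : HolSpace U →L[ℂ] HolSpace U) (w : ℕ → ℂ) : Prop where
  weight_ne_zero : ∀ n, 1 ≤ n → w n ≠ 0
  map_zero : T (HolSpace.monomial U 0) = 0
  map_succ : ∀ n, T (HolSpace.monomial U (n + 1)) = w (n + 1) • HolSpace.monomial U n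

/-- `β n = w 1 * ⋯ * w n`, with `β 0 = 1`. -/
noncomputable def weightProd (w : ℕ → ℂ) (n : ℕ) : ℂ := ∏ k ∈ Finset.Icc 1 n, w k

section Dynamics

variable {E : Type*} [TopologicalSpace E]

/-- A vector is hypercyclic for `T` if its orbit is dense. -/
def IsHypercyclicVector (T : E → E) (x : E) : Prop := Dense (Set.range fun n : ℕ => T^[n] x)

/-- A map (here always a continuous linear operator) is chaotic if it has a hypercyclic vector and a dense set of periodic points. -/
def IsChaotic (T : E → E) : Prop :=
  (∃ x, IsHypercyclicVector T x) ∧ Dense (Function.periodicPts T)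

/-- The lower density `liminf_N card {n ∈ A | n ≤ N} / (N + 1)` of a set of natural numbers. -/
noncomputable def lowerDensity (A : Set ℕ) : ℝ :=
  liminf (fun N : ℕ => ((A ∩ Set.Iic N).ncard : ℝ) / (N + 1)) atTop

/-- A vector is frequently hypercyclic for `T` if its orbit visits every nonempty open set along a
set of times of positive lower density. -/
def IsFrequentlyHypercyclicVector (T : E → E) (x : E) : Prop :=
  ∀ V : Set E, IsOpen V → V.Nonempty → 0 < lowerDensity {n : ℕ | T^[n] x ∈ V}

end Dynamics

/-- `μ` is an exact measure for `f`: a probability measure, invariant under `f`, for which every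
set in the tail sigma-algebra `⋂ n, f^{-n}(Σ)` has measure `0` or `1`. -/
structure IsExactMeasure {E : Type*} [MeasurableSpace E] (f : E → E) (μ : Measure E) : Prop where
  isProbabilityMeasure : IsProbabilityMeasure μ
  measurePreserving : MeasurePreserving f μ μ
  zero_or_one : ∀ A : Set E, (∀ n : ℕ, ∃ B : Set E, MeasurableSet B ∧ f^[n] ⁻¹' B = A) →
    μ A = 0 ∨ μ A = 1

section RandomVariables

variable {Ω : Type*} [MeasurableSpace Ω]

/-- A complex random variable is subgaussian if `P (|X| ≥ t) ≤ C exp (- c t ^ 2)` for all `t ≥ 0`,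
for some constants `C, c > 0`. No centering is required. -/
def IsSubgaussian (P : Measure Ω) (X : Ω → ℂ) : Prop :=
  ∃ C c : ℝ, 0 < C ∧ 0 < c ∧
    ∀ t : ℝ, 0 ≤ t → P.real {ω | t ≤ ‖X ω‖} ≤ C * Real.exp (-c * t ^ 2)

/-- A complex random variable has full support if it hits every nonempty open subset of `ℂ` with
positive probability. -/
def HasFullSupport (P : Measure Ω) (X : Ω → ℂ) : Prop :=
  (P.map X).IsOpenPosMeasure

/-- A complex random variable is a nondegenerate Gaussian if its real and imaginary parts are jointly
Gaussian and it is not almost surely contained in a real line of `ℂ`. The mean is arbitrary. For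
a circularly symmetric complex Gaussian (independent real and imaginary parts with the same
variance) nondegenerate is the same as not almost surely constant. -/
def IsNondegenerateGaussian (P : Measure Ω) (X : Ω → ℂ) : Prop :=
  IsGaussian (P.map X) ∧
    ∀ L : ℂ →L[ℝ] ℝ, L ≠ 0 → ¬ ∃ c : ℝ, ∀ᵐ ω ∂P, L (X ω) = c

end RandomVariables

/-- The random function `∑ (X n / β n) z ^ n`, as an infinite sum in `H(U)`. -/
noncomputable def randomFunction (U : Opens ℂ) (w : ℕ → ℂ) {Ω : Type*} (X : ℕ → Ω → ℂ) (ω : Ω) :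
    HolSpace U :=
  ∑' n : ℕ, (X n ω / weightProd w n) • HolSpace.monomial U n

/-! In the normalized coefficients `T` is the left shift: if `f = ∑ (x n / β n) z ^ n`, then `T f`
has coefficient sequence `x (n + 1)`. So `v` is the image of an i.i.d. sequence under a map
`coeffSeries` intertwining the Bernoulli shift with `T`, and its law inherits invariance and,
through Kolmogorov's zero-one law, exactness (`isExactMeasure_map_coeffSeries`).

Chaos is needed for convergence (`exists_bound_of_isChaotic`). Take a periodic point `x` with `x(0)
≠ 0`. For each `n`, one of its finitely many iterates has `n`-th Taylor coefficient `x(0) / β n`, so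
Cauchy's estimates bound `r ^ n / |β n|` whenever the closed disc of radius `r` lies in `U`. Such a
disc lies in a larger one, which leaves room for coefficients of linear growth, and Borel–Cantelli
puts `X n` in that class almost surely. All that is used of the tails of `X` is that `∑ P(|X| > n)`
converges, which covers subgaussian and Gaussian variables alike.

For full support (`isOpenPosMeasure_map_coeffSeries`), the first coefficients are close to those of
a prescribed polynomial with positive probability, and independently the remainder is small with
positive probability. Frequent hypercyclicity then follows from ergodicity and one half of the
pointwise ergodic theorem (`Ergodic.ae_lowerDensity_pos`), applied to a countable base. -/

namespace HolSpace

/-! ### Power series and Cauchy estimates in `H(U)` -/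

variable {U : Opens ℂ}

instance : ContinuousAdd (HolSpace U) := (HolSpace U).topologicalAddGroup.toContinuousAdd

instance : ContinuousSub (HolSpace U) :=
  ⟨((continuous_subtype_val.comp continuous_fst).sub
    (continuous_subtype_val.comp continuous_snd)).subtype_mk _⟩

instance : SecondCountableTopology (HolSpace U) :=
  have : LocallyCompactSpace U := U.isOpen.locallyCompactSpace
  Topology.IsInducing.subtypeVal.secondCountableTopology

instance : PseudoMetrizableSpace (HolSpace U) :=
  have : LocallyCompactSpace U := U.isOpen.locallyCompactSpace
  Topology.IsInducing.subtypeVal.pseudoMetrizableSpace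

@[simp] lemma coe_monomial (n : ℕ) (z : U) : (monomial U n : C(U, ℂ)) z = (z : ℂ) ^ n := rfl

/-- Every point of `U` lies in the interior of a closed disc about `0` contained in `U`. -/
def DiscExhausted (U : Opens ℂ) : Prop :=
  ∀ z ∈ U, ∃ r : ℝ, ‖z‖ < r ∧ Metric.closedBall (0 : ℂ) r ⊆ U

lemma discExhausted_of_eq_univ_or_ball
    (hU : (U : Set ℂ) = Set.univ ∨ ∃ R : ℝ, 0 < R ∧ (U : Set ℂ) = Metric.ball 0 R) :
    DiscExhausted U := by
  intro z hz
  rcases hU with h | ⟨R, -, h⟩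
  · exact ⟨‖z‖ + 1, by linarith, by simp [h]⟩
  · rw [← SetLike.mem_coe, h, mem_ball_zero_iff] at hz
    obtain ⟨r, h1, h2⟩ := exists_between hz
    exact ⟨r, h1, h ▸ Metric.closedBall_subset_ball h2⟩

lemma zero_mem_of_eq_univ_or_ball
    (hU : (U : Set ℂ) = Set.univ ∨ ∃ R : ℝ, 0 < R ∧ (U : Set ℂ) = Metric.ball 0 R) :
    (0 : ℂ) ∈ U := by
  rw [← SetLike.mem_coe]
  rcases hU with h | ⟨R, hR, h⟩
  · simp [h]
  · simpa [h] using hR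

/-- The norm attains its maximum on `K`, and a disc around that point of the maximum suffices. This
reduces convergence in `H(U)` to the Weierstrass test on centred discs. -/
lemma exists_radius_of_isCompact (hD : DiscExhausted U) (h0 : (0 : ℂ) ∈ U) {K : Set U}
    (hK : IsCompact K) :
    ∃ r : ℝ, 0 < r ∧ Metric.closedBall (0 : ℂ) r ⊆ U ∧ ∀ z ∈ K, ‖(z : ℂ)‖ ≤ r := by
  rcases K.eq_empty_or_nonempty with rfl | hne
  · obtain ⟨r, h1, h2⟩ := hD 0 h0
    exact ⟨r, by simpa using h1, h2, by simp⟩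
  · obtain ⟨z, -, hz⟩ := hK.exists_isMaxOn hne
      (f := fun z : U => ‖(z : ℂ)‖) (by fun_prop)
    obtain ⟨r, h1, h2⟩ := hD z z.2
    exact ⟨r, (norm_nonneg _).trans_lt h1, h2, fun y hy => (hz hy).trans h1.le⟩

/-- A power series which converges absolutely on the closed discs in `U` converges
unconditionally in `H(U)` to any function having the same pointwise sum. -/
lemma hasSum_smul_monomial (hD : DiscExhausted U) (h0 : (0 : ℂ) ∈ U) {c : ℕ → ℂ}
    (hc : ∀ r : ℝ, 0 < r → Metric.closedBall (0 : ℂ) r ⊆ U → Summable fun n => ‖c n‖ * r ^ n)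
    {f : HolSpace U} (hf : ∀ z : U, (f : C(U, ℂ)) z = ∑' n, c n * (z : ℂ) ^ n) :
    HasSum (fun n => c n • monomial U n) f := by
  have key : Tendsto (fun s : Finset ℕ => ((∑ n ∈ s, c n • monomial U n : HolSpace U) : C(U, ℂ)))
      atTop (𝓝 (f : C(U, ℂ))) := by
    rw [ContinuousMap.tendsto_iff_forall_isCompact_tendstoUniformlyOn]
    intro K hK
    obtain ⟨r, hr, hrU, hKr⟩ := exists_radius_of_isCompact hD h0 hK
    have := tendstoUniformlyOn_tsum (hc r hr hrU) (s := K)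
      (f := fun n (z : U) => c n * (z : ℂ) ^ n) (fun n z hz => by
        rw [norm_mul, norm_pow]
        gcongr
        exact hKr z hz)
    refine (this.congr (Eventually.of_forall fun s z hz => ?_)).congr_right fun z hz => (hf z).symm
    simp
  exact (Topology.IsInducing.subtypeVal.tendsto_nhds_iff).2 key

lemma exists_hasSum_smul_monomial (hD : DiscExhausted U) (h0 : (0 : ℂ) ∈ U) {c : ℕ → ℂ}
    (hc : ∀ r : ℝ, 0 < r → Metric.closedBall (0 : ℂ) r ⊆ U → Summable fun n => ‖c n‖ * r ^ n) :
    ∃ f : HolSpace U, HasSum (fun n => c n • monomial U n) f := by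
  set g : ℂ → ℂ := fun z => ∑' n, c n * z ^ n with hg
  have hd : DifferentiableOn ℂ g U := by
    intro z hz
    obtain ⟨r, h1, h2⟩ := hD z hz
    have hr : 0 < r := (norm_nonneg _).trans_lt h1
    have := Complex.differentiableOn_tsum_of_summable_norm (hc r hr h2)
      (F := fun n z => c n * z ^ n) (U := Metric.ball 0 r) (fun n => by fun_prop)
      Metric.isOpen_ball (fun n w hw => by
        rw [norm_mul, norm_pow]
        gcongr
        exact (mem_ball_zero_iff.1 hw).le)
    exact (this.differentiableAt
      (Metric.isOpen_ball.mem_nhds (mem_ball_zero_iff.2 h1))).differentiableWithinAt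
  exact ⟨⟨⟨fun z => g z, (hd.continuousOn).comp_continuous (by fun_prop) fun z => z.2⟩,
    g, hd, fun _ => rfl⟩, hasSum_smul_monomial hD h0 hc fun z => rfl⟩

/-- A sequence bounded by `M / r ^ n` for all closed discs in `U`, up to a factor `n + 1`, is the
coefficient sequence of a function in `H(U)`. -/
lemma summable_of_forall_bound (hD : DiscExhausted U) {c : ℕ → ℂ}
    (hc : ∀ r : ℝ, 0 < r → Metric.closedBall (0 : ℂ) r ⊆ U →
      ∃ M : ℝ, ∀ n : ℕ, ‖c n‖ * r ^ n ≤ M * (n + 1)) {r : ℝ} (hr : 0 < r)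
    (hrU : Metric.closedBall (0 : ℂ) r ⊆ U) : Summable fun n => ‖c n‖ * r ^ n := by
  -- The boundary point `r` of the disc yields a strictly larger radius `s`; the geometric factor
  -- `(r / s) ^ n` absorbs `n + 1`.
  obtain ⟨s, hs, hsU⟩ := hD (r : ℂ) (hrU (by simp [abs_of_pos hr]))
  rw [Complex.norm_real, Real.norm_of_nonneg hr.le] at hs
  have hs0 : 0 < s := hr.trans hs
  obtain ⟨M, hM⟩ := hc s hs0 hsU
  have hq : ‖r / s‖ < 1 := by
    rw [Real.norm_of_nonneg (by positivity), div_lt_one hs0]; exact hs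
  have h1 : Summable fun n : ℕ => M * ((n + 1 : ℝ) * (r / s) ^ n) := by
    refine Summable.mul_left _ ?_
    have := (summable_pow_mul_geometric_of_norm_lt_one 1 hq).add
      (summable_geometric_of_norm_lt_one hq)
    refine this.congr fun n => by ring
  refine Summable.of_nonneg_of_le (fun n => by positivity) (fun n => ?_) h1
  calc ‖c n‖ * r ^ n = (‖c n‖ * s ^ n) * (r / s) ^ n := by
        rw [div_pow]; field_simp
    _ ≤ (M * (n + 1)) * (r / s) ^ n := by exact mul_le_mul_of_nonneg_right (hM n) (by positivity)
    _ = _ := by ring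

/-- Taylor expansion in `H(U)`, with Cauchy's estimates. -/
lemma exists_taylor (hD : DiscExhausted U) (h0 : (0 : ℂ) ∈ U) (f : HolSpace U) :
    ∃ c : ℕ → ℂ, HasSum (fun n => c n • monomial U n) f ∧
      ∀ r : ℝ, 0 < r → Metric.closedBall (0 : ℂ) r ⊆ U → ∃ M : ℝ, ∀ n, ‖c n‖ * r ^ n ≤ M := by
  obtain ⟨g, hg, hfg⟩ := f.2
  set c : ℕ → ℂ := fun n => (n.factorial : ℂ)⁻¹ * iteratedDeriv n g 0 with hc
  have hb : ∀ r : ℝ, 0 < r → Metric.closedBall (0 : ℂ) r ⊆ U →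
      ∃ M : ℝ, ∀ n, ‖c n‖ * r ^ n ≤ M := by
    intro r hr hrU
    obtain ⟨M, hM⟩ := (isCompact_closedBall (0 : ℂ) r).exists_bound_of_continuousOn
      (hg.continuousOn.mono hrU)
    refine ⟨M, fun n => ?_⟩
    have hcl : DiffContOnCl ℂ g (Metric.ball 0 r) :=
      DifferentiableOn.diffContOnCl (hg.mono (Metric.closure_ball_subset_closedBall.trans hrU))
    have := Complex.norm_iteratedDeriv_le_of_forall_mem_sphere_norm_le n hr hcl
      (fun z hz => hM z (Metric.sphere_subset_closedBall hz))
    rw [hc, norm_mul, norm_inv, Complex.norm_natCast]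
    calc _ ≤ ((n.factorial : ℝ))⁻¹ * (n.factorial * M / r ^ n) * r ^ n := by gcongr
      _ = M := by
        have : (n.factorial : ℝ) ≠ 0 := by positivity
        field_simp
  refine ⟨c, hasSum_smul_monomial hD h0 (fun r hr hrU => ?_) fun z => ?_, hb⟩
  · refine summable_of_forall_bound hD (fun r hr hrU => ?_) hr hrU
    obtain ⟨M, hM⟩ := hb r hr hrU
    have hM0 : 0 ≤ M := (by positivity : (0 : ℝ) ≤ ‖c 0‖ * r ^ 0).trans (hM 0)
    refine ⟨M, fun n => (hM n).trans ?_⟩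
    nlinarith [(n.cast_nonneg : (0 : ℝ) ≤ n)]
  · obtain ⟨r, h1, h2⟩ := hD z z.2
    have := Complex.hasSum_taylorSeries_on_ball
      (hg.mono (Metric.ball_subset_closedBall.trans h2)) (mem_ball_zero_iff.2 h1)
    rw [hfg z, ← this.tsum_eq]
    refine tsum_congr fun n => ?_
    simp only [hc, sub_zero, smul_eq_mul]
    ring

end HolSpace

/-! ### Weighted shifts in normalized coefficients, and the consequence of chaos -/

lemma weightProd_zero (w : ℕ → ℂ) : weightProd w 0 = 1 := by simp [weightProd]

lemma weightProd_succ (w : ℕ → ℂ) (n : ℕ) : weightProd w (n + 1) = weightProd w n * w (n + 1) := by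
  simp [weightProd, Finset.prod_Icc_succ_top]

namespace IsWeightedShift

open HolSpace

variable {U : Opens ℂ} {T : HolSpace U →L[ℂ] HolSpace U} {w : ℕ → ℂ}

lemma weightProd_ne_zero (hT : IsWeightedShift T w) (n : ℕ) : weightProd w n ≠ 0 :=
  Finset.prod_ne_zero_iff.2 fun k hk => hT.weight_ne_zero k (Finset.mem_Icc.1 hk).1

/-- The shift acts on normalized power series by shifting the coefficients. -/
lemma hasSum_map (hT : IsWeightedShift T w) {x : ℕ → ℂ} {f : HolSpace U}
    (hf : HasSum (fun n => (x n / weightProd w n) • monomial U n) f) :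
    HasSum (fun n => (x (n + 1) / weightProd w n) • monomial U n) (T f) := by
  have h' : HasSum (fun n => T ((x n / weightProd w n) • monomial U n)) (T f) :=
    hf.map T T.continuous
  have hz : T ((x 0 / weightProd w 0) • monomial U 0) = 0 := by
    rw [map_smul, hT.map_zero, smul_zero]
  have h := (hasSum_nat_add_iff (G := HolSpace U) 1 (g := T f)
    (f := fun n => T ((x n / weightProd w n) • monomial U n))).2 (by
      rw [Finset.sum_range_one, hz, add_zero]; exact h')
  refine h.congr_fun fun n => ?_
  have h1 := hT.weight_ne_zero (n + 1) (by omega)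
  have h2 := hT.weightProd_ne_zero n
  rw [map_smul, hT.map_succ, smul_smul, weightProd_succ]
  congr 1
  field_simp

lemma hasSum_iterate (hT : IsWeightedShift T w) {x : ℕ → ℂ} {f : HolSpace U}
    (hf : HasSum (fun n => (x n / weightProd w n) • monomial U n) f) (k : ℕ) :
    HasSum (fun n => (x (n + k) / weightProd w n) • monomial U n) (T^[k] f) := by
  induction k with
  | zero => simpa using hf
  | succ k ih =>
    rw [Function.iterate_succ_apply']
    have := hT.hasSum_map (x := fun n => x (n + k)) ih
    refine this.congr_fun fun n => ?_
    rw [show n + 1 + k = n + (k + 1) by ring]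

/-- The value at `0` of an iterate is the corresponding normalized coefficient. -/
lemma iterate_apply_zero (hT : IsWeightedShift T w) (h0 : (0 : ℂ) ∈ U) {x : ℕ → ℂ}
    {f : HolSpace U} (hf : HasSum (fun n => (x n / weightProd w n) • monomial U n) f) (k : ℕ) :
    ((T^[k] f : HolSpace U) : C(U, ℂ)) ⟨0, h0⟩ = x k := by
  have h := ContinuousMap.hasSum_apply
    ((hT.hasSum_iterate hf k).mapL (HolSpace U).subtypeL) ⟨0, h0⟩
  refine h.unique ?_
  convert hasSum_ite_eq 0 (x k) using 2 with n
  by_cases hn : n = 0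
  · subst hn; simp [weightProd_zero]
  · simp [hn]

/-- If the shift is chaotic, the sequence `1 / β n` satisfies Cauchy's estimates of a function
in `H(U)`. -/
lemma exists_bound_of_isChaotic (hT : IsWeightedShift T w) (hD : DiscExhausted U)
    (h0 : (0 : ℂ) ∈ U) (hchaos : IsChaotic T) {r : ℝ} (hr : 0 < r)
    (hrU : Metric.closedBall (0 : ℂ) r ⊆ U) :
    ∃ M : ℝ, ∀ n, ‖(weightProd w n)⁻¹‖ * r ^ n ≤ M := by
  set e : HolSpace U → ℂ := fun f => (f : C(U, ℂ)) ⟨0, h0⟩ with he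
  have hcont : Continuous e := by fun_prop
  obtain ⟨x, hx0, hxper⟩ : ∃ x, e x ≠ 0 ∧ x ∈ Function.periodicPts T := by
    have he0 : e (monomial U 0) ≠ 0 := by simp [he]
    have ho : IsOpen {x | e x ≠ 0} := isOpen_ne_fun hcont continuous_const
    exact hchaos.2.inter_open_nonempty _ ho ⟨monomial U 0, he0⟩
  obtain ⟨N, hN, hper⟩ := hxper
  choose c hc hcb using exists_taylor hD h0
  choose M hM using fun j => hcb (T^[j] x) r hr hrU
  -- The exponent `j` below runs through `1, …, N`, hence `N + 1`.
  obtain ⟨B, hB⟩ := ((Finset.range (N + 1)).image M).exists_le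
  refine ⟨B / ‖e x‖, fun n => ?_⟩
  rw [le_div_iff₀ (norm_pos_iff.2 hx0)]
  -- With this choice `n + j` is a multiple of the period, so `n` further steps bring `T^[j] x` back
  -- to `x`.
  set j := N - n % N with hj
  have hdvd : (T^[n]) (T^[j] x) = x := by
    rw [← Function.iterate_add_apply]
    have : n + j = N * (n / N + 1) := by
      have h1 := Nat.div_add_mod n N
      have h2 := Nat.mod_lt n hN
      rw [mul_add, mul_one]; omega
    rw [this]
    exact hper.mul_const _
  have hcn : c (T^[j] x) n * weightProd w n = e x := by
    have := hT.iterate_apply_zero h0 (f := T^[j] x)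
      (x := fun n => c (T^[j] x) n * weightProd w n) (by
        refine (hc (T^[j] x)).congr_fun fun n => ?_
        rw [mul_div_cancel_right₀ _ (hT.weightProd_ne_zero n)]) n
    rw [hdvd] at this
    exact this.symm
  have h2 : c (T^[j] x) n = (weightProd w n)⁻¹ * e x := by
    rw [← hcn]; field_simp [hT.weightProd_ne_zero n]
  calc ‖(weightProd w n)⁻¹‖ * r ^ n * ‖e x‖ = ‖c (T^[j] x) n‖ * r ^ n := by
        rw [h2, norm_mul]; ring
    _ ≤ M j := hM j n
    _ ≤ B := hB _ (Finset.mem_image_of_mem M (Finset.mem_range.2 (by omega)))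

/-- If the shift is chaotic, a sequence of at most linear growth is the sequence of normalized
coefficients of a function in `H(U)`. -/
lemma summable_of_linear_growth (hT : IsWeightedShift T w) (hD : DiscExhausted U)
    (h0 : (0 : ℂ) ∈ U) (hchaos : IsChaotic T) {x : ℕ → ℂ} {C : ℝ}
    (hx : ∀ n : ℕ, ‖x n‖ ≤ C * (n + 1)) :
    Summable fun n => (x n / weightProd w n) • monomial U n := by
  obtain ⟨f, hf⟩ := exists_hasSum_smul_monomial (c := fun n => x n / weightProd w n) hD h0
    fun r hr hrU => summable_of_forall_bound hD (fun r hr hrU => by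
      obtain ⟨M, hM⟩ := hT.exists_bound_of_isChaotic hD h0 hchaos hr hrU
      refine ⟨C * M, fun n => ?_⟩
      calc ‖x n / weightProd w n‖ * r ^ n = ‖x n‖ * (‖(weightProd w n)⁻¹‖ * r ^ n) := by
            rw [div_eq_mul_inv, norm_mul]; ring
        _ ≤ (C * (n + 1)) * M := by
            gcongr
            · exact (norm_nonneg _).trans (hx n)
            · exact hx n
            · exact hM n
        _ = _ := by ring) hr hrU
  exact hf.summable

end IsWeightedShift

/-! ### Lower density of visits under an ergodic map -/

section Ergodic

lemma isBoundedUnder_ge_density (A : Set ℕ) :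
    IsBoundedUnder (· ≥ ·) atTop fun N : ℕ => ((A ∩ Set.Iic N).ncard : ℝ) / (N + 1) :=
  isBoundedUnder_of ⟨0, fun N => by positivity⟩

lemma isCoboundedUnder_ge_density (A : Set ℕ) :
    IsCoboundedUnder (· ≥ ·) atTop fun N : ℕ => ((A ∩ Set.Iic N).ncard : ℝ) / (N + 1) := by
  refine IsBoundedUnder.isCoboundedUnder_ge (isBoundedUnder_of ⟨1, fun N => ?_⟩)
  rw [div_le_one (by positivity)]
  have h := Set.ncard_le_ncard (Set.inter_subset_right : A ∩ Set.Iic N ⊆ Set.Iic N)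
    (Set.finite_Iic N)
  rw [← Finset.coe_Iic, Set.ncard_coe_finset, Nat.card_Iic] at h
  rw [← Finset.coe_Iic]
  exact_mod_cast h

lemma lowerDensity_mono {A B : Set ℕ} (h : A ⊆ B) : lowerDensity A ≤ lowerDensity B := by
  refine liminf_le_liminf (Eventually.of_forall fun N => ?_) (isBoundedUnder_ge_density A)
    (isCoboundedUnder_ge_density B)
  have := Set.ncard_le_ncard (Set.inter_subset_inter_left (Set.Iic N) h)
    ((Set.finite_Iic N).inter_of_right B)
  gcongr

variable {α : Type*} {f : α → α}

/-- If `g' ≤ min g 1` is nonpositive at every point without an average of `g` over a time in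
`[1, M]` of at most `c`, then the sum of `g'` over a time `L` is at most `c * L + M`. -/
lemma birkhoffSum_le_of_forall_exists {g g' : α → ℝ} {c : ℝ} (hc : 0 ≤ c) {M : ℕ}
    (hle : ∀ x, g' x ≤ g x) (hone : ∀ x, g' x ≤ 1)
    (h : ∀ x, g' x ≤ 0 ∨ ∃ n, 1 ≤ n ∧ n ≤ M ∧ birkhoffSum f g n x ≤ c * n) (L : ℕ) (x : α) :
    birkhoffSum f g' L x ≤ c * L + M := by
  induction L using Nat.strong_induction_on generalizing x with
  | _ L ih =>
    -- The orbit is cut greedily into single points where `g' ≤ 0` and blocks of length at most `M`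
    -- with average at most `c`. The last piece has length at most `M` and costs at most `M` since
    -- `g' ≤ 1`.
    by_cases hL : L ≤ M
    · have : birkhoffSum f g' L x ≤ L := by
        unfold birkhoffSum
        exact (Finset.sum_le_card_nsmul _ _ 1 fun i _ => hone _).trans (by simp)
      have : (L : ℝ) ≤ M := by exact_mod_cast hL
      have : 0 ≤ c * L := by positivity
      linarith
    push Not at hL
    rcases h x with h0 | ⟨n, hn1, hnM, hn⟩
    · obtain ⟨k, rfl⟩ : ∃ k, L = k + 1 := ⟨L - 1, by omega⟩
      rw [birkhoffSum_succ']
      have := ih k (by omega) (f x)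
      push_cast
      linarith
    · obtain ⟨k, rfl⟩ : ∃ k, L = n + k := ⟨L - n, by omega⟩
      rw [birkhoffSum_add]
      have h1 := ih k (by omega) (f^[n] x)
      have h2 : birkhoffSum f g' n x ≤ birkhoffSum f g n x :=
        Finset.sum_le_sum fun i _ => hle _
      push_cast
      linarith

lemma birkhoffSum_indicator_eq_ncard (f : α → α) (S : Set α) (N : ℕ) (x : α) :
    (({n : ℕ | f^[n] x ∈ S} ∩ Set.Iic N).ncard : ℝ) =
      birkhoffSum f (S.indicator (1 : α → ℝ)) (N + 1) x := by
  classical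
  have : {n : ℕ | f^[n] x ∈ S} ∩ Set.Iic N =
      ((Finset.range (N + 1)).filter fun n => f^[n] x ∈ S : Finset ℕ) := by
    ext n; simp [and_comm]
  rw [this, Set.ncard_coe_finset, Finset.card_filter, birkhoffSum]
  push_cast
  exact Finset.sum_congr rfl fun n _ => by simp [Set.indicator_apply]

variable [MeasurableSpace α] {μ : Measure α}

lemma measurable_birkhoffSum (hf : Measurable f) {g : α → ℝ} (hg : Measurable g) (n : ℕ) :
    Measurable (birkhoffSum f g n) := by
  unfold birkhoffSum
  exact Finset.measurable_fun_sum _ fun i _ => hg.comp (hf.iterate i)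

lemma MeasureTheory.MeasurePreserving.integral_birkhoffSum (hf : MeasurePreserving f μ μ)
    {g : α → ℝ} (hg : Integrable g μ) (n : ℕ) :
    ∫ x, birkhoffSum f g n x ∂μ = n * ∫ x, g x ∂μ := by
  unfold birkhoffSum
  have hi : ∀ i, MeasurePreserving f^[i] μ μ := fun i => hf.iterate i
  have hint : ∀ i, Integrable (fun x => g (f^[i] x)) μ := fun i =>
    (hi i).integrable_comp_of_integrable hg
  rw [integral_finsetSum _ fun i _ => hint i]
  have : ∀ i, ∫ x, g (f^[i] x) ∂μ = ∫ x, g x ∂μ := fun i => by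
    have hg' : AEStronglyMeasurable g (μ.map f^[i]) := by
      rw [(hi i).map_eq]; exact hg.aestronglyMeasurable
    rw [← integral_map (hi i).aemeasurable hg', (hi i).map_eq]
  simp [this]

/-- One half of the pointwise ergodic theorem: if almost every point has some average of `g` at
most `c`, then the space average of `g` is at most `c`. -/
lemma integral_le_of_ae_exists_birkhoffSum_le [IsProbabilityMeasure μ]
    (hf : MeasurePreserving f μ μ) {g : α → ℝ} (hg : Measurable g) (hg0 : ∀ x, 0 ≤ g x)
    (hg1 : ∀ x, g x ≤ 1) {c : ℝ} (hc : 0 ≤ c)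
    (h : ∀ᵐ x ∂μ, ∃ n : ℕ, 1 ≤ n ∧ birkhoffSum f g n x ≤ c * n) :
    ∫ x, g x ∂μ ≤ c := by
  have hint : ∀ {g' : α → ℝ}, Measurable g' → (∀ x, 0 ≤ g' x) → (∀ x, g' x ≤ 1) →
      Integrable g' μ := fun hm h0 h1 =>
    Integrable.of_bound hm.aestronglyMeasurable 1 (ae_of_all _ fun x => by
      rw [Real.norm_of_nonneg (h0 x)]; exact h1 x)
  set B : ℕ → Set α := fun M => {x | ∀ n, 1 ≤ n → n ≤ M → c * n < birkhoffSum f g n x} with hB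
  have hBm : ∀ M, MeasurableSet (B M) := fun M => by
    have : B M = ⋂ n : ℕ, ⋂ (_ : 1 ≤ n), ⋂ (_ : n ≤ M), {x | c * n < birkhoffSum f g n x} := by
      ext x; simp [hB]
    rw [this]
    exact .iInter fun n => .iInter fun _ => .iInter fun _ =>
      measurableSet_lt measurable_const (measurable_birkhoffSum hf.measurable hg n)
  have hBanti : Antitone B := fun M M' hM x hx n h1 h2 => hx n h1 (h2.trans hM)
  have hBnull : μ (⋂ M, B M) = 0 := by
    refine measure_mono_null ?_ (ae_iff.1 h)
    intro x hx
    simp only [Set.mem_iInter] at hx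
    rintro ⟨n, h1, h2⟩
    exact (hx n n h1 le_rfl).not_ge h2
  have hlim : Tendsto (fun M => c + μ.real (B M)) atTop (𝓝 (c + 0)) := by
    refine tendsto_const_nhds.add ?_
    have := tendsto_measure_iInter_atTop (μ := μ) (fun M => (hBm M).nullMeasurableSet) hBanti
      ⟨0, measure_ne_top _ _⟩
    rw [hBnull] at this
    exact (ENNReal.tendsto_toReal ENNReal.zero_ne_top).comp this
  rw [add_zero] at hlim
  refine ge_of_tendsto' hlim fun M => ?_
  -- Killing `g` on `B M` makes the waiting time uniformly bounded and changes the integral by at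
  -- most the measure of `B M`.
  set g' : α → ℝ := (B M)ᶜ.indicator g with hg'
  have hm' : Measurable g' := hg.indicator (hBm M).compl
  have h0' : ∀ x, 0 ≤ g' x := fun x => Set.indicator_nonneg (fun x _ => hg0 x) x
  have hle' : ∀ x, g' x ≤ g x := fun x => Set.indicator_le_self' (fun x _ => hg0 x) x
  have h1' : ∀ x, g' x ≤ 1 := fun x => (hle' x).trans (hg1 x)
  have key : ∀ L x, birkhoffSum f g' L x ≤ c * L + M := by
    refine birkhoffSum_le_of_forall_exists hc hle' h1' fun x => ?_
    by_cases hx : x ∈ B M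
    · left; simp [hg', hx]
    · right
      simp only [hB, Set.mem_ofPred_eq] at hx
      push Not at hx
      exact hx
  have hL : ∀ L : ℕ, L * ∫ x, g' x ∂μ ≤ c * L + M := fun L => by
    rw [← hf.integral_birkhoffSum (hint hm' h0' h1') L]
    calc ∫ x, birkhoffSum f g' L x ∂μ ≤ ∫ _, (c * L + M : ℝ) ∂μ := by
          refine integral_mono_of_nonneg (ae_of_all _ fun x => ?_) (integrable_const _)
            (ae_of_all _ fun x => key L x)
          exact Finset.sum_nonneg fun i _ => h0' _
      _ = c * L + M := by simp
  have hg'c : ∫ x, g' x ∂μ ≤ c := by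
    by_contra! hcon
    obtain ⟨L, hL'⟩ := exists_nat_gt (M / ((∫ x, g' x ∂μ) - c))
    rw [div_lt_iff₀ (by linarith)] at hL'
    have := hL L
    nlinarith
  have hintB : Integrable ((B M).indicator (1 : α → ℝ)) μ :=
    (integrable_const (1 : ℝ)).indicator (hBm M)
  calc ∫ x, g x ∂μ ≤ ∫ x, (g' x + (B M).indicator 1 x) ∂μ := by
        refine integral_mono (hint hg hg0 hg1) ((hint hm' h0' h1').add hintB) fun x => ?_
        by_cases hx : x ∈ B M
        · simpa [hg', hx] using hg1 x
        · simp [hg', hx]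
    _ = ∫ x, g' x ∂μ + μ.real (B M) := by
        rw [integral_add (hint hm' h0' h1') hintB,
          integral_indicator_one (hBm M)]
    _ ≤ c + μ.real (B M) := by gcongr

/-- Almost every orbit of an ergodic map visits a set of positive measure along a set of times of
positive lower density. -/
lemma Ergodic.ae_lowerDensity_pos [IsProbabilityMeasure μ] (hf : Ergodic f μ) {S : Set α}
    (hS : MeasurableSet S) (hpos : 0 < μ S) :
    ∀ᵐ x ∂μ, 0 < lowerDensity {n : ℕ | f^[n] x ∈ S} := by
  set g : α → ℝ := S.indicator 1 with hg
  have hgm : Measurable g := measurable_one.indicator hS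
  have hg0 : ∀ x, 0 ≤ g x := fun x => Set.indicator_nonneg (fun _ _ => zero_le_one) x
  have hg1 : ∀ x, g x ≤ 1 := fun x => Set.indicator_le_self' (fun _ _ => zero_le_one) x
  -- The points whose averages have lower limit zero.
  set D : Set α := {x | ∀ k : ℕ, ∃ᶠ n : ℕ in atTop, birkhoffSum f g n x * (k + 1) < n} with hD
  have hDm : MeasurableSet D := by
    have : D = ⋂ k : ℕ, ⋂ m : ℕ, ⋃ n : ℕ, ⋃ (_ : m ≤ n),
        {x | birkhoffSum f g n x * (k + 1) < n} := by
      ext x; simp [hD, frequently_atTop]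
    rw [this]
    exact .iInter fun k => .iInter fun m => .iUnion fun n => .iUnion fun _ =>
      measurableSet_lt ((measurable_birkhoffSum hf.measurable hgm n).mul_const _)
        measurable_const
  have hDinv : D ⊆ f ⁻¹' D := by
    intro x hx k
    rw [frequently_atTop]
    intro m
    -- Passing from `n = j + 1` to `j` may cost a factor of two, since `j + 1 ≤ 2 * j` for `j ≥ 1`;
    -- `2 * k + 1` turns `k + 1` into `2 * (k + 1)` to pay for it.
    obtain ⟨n, hn, hlt⟩ := frequently_atTop.1 (hx (2 * k + 1)) (m + 2)
    obtain ⟨j, rfl⟩ : ∃ j, n = j + 1 := ⟨n - 1, by omega⟩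
    refine ⟨j, by omega, ?_⟩
    rw [birkhoffSum_succ'] at hlt
    push_cast at hlt
    have hj : (1 : ℝ) ≤ j := by exact_mod_cast (by omega : 1 ≤ j)
    have := hg0 x
    have hk : (0 : ℝ) ≤ k := k.cast_nonneg
    nlinarith [mul_nonneg this hk]
  have hDnull : μ D = 0 := by
    rcases hf.ae_empty_or_univ_of_ae_le_preimage hDm.nullMeasurableSet
      hDinv.eventuallyLE with h | h
    · simpa using measure_congr h
    · exfalso
      have hS0 : 0 < μ.real S := ENNReal.toReal_pos hpos.ne' (measure_ne_top _ _)
      obtain ⟨k, hk⟩ := exists_nat_one_div_lt hS0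
      have hae : ∀ᵐ x ∂μ, ∃ n : ℕ, 1 ≤ n ∧ birkhoffSum f g n x ≤ (1 / (k + 1 : ℝ)) * n := by
        filter_upwards [eventuallyEq_univ.1 h] with x hx
        obtain ⟨n, hn, hlt⟩ := frequently_atTop.1 (hx k) 1
        refine ⟨n, hn, ?_⟩
        rw [one_div_mul_eq_div, le_div_iff₀ (by positivity)]
        exact hlt.le
      have := integral_le_of_ae_exists_birkhoffSum_le hf.toMeasurePreserving hgm hg0 hg1
        (by positivity) hae
      rw [hg, integral_indicator_one hS] at this
      linarith
  filter_upwards [measure_eq_zero_iff_ae_notMem.1 hDnull] with x hx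
  simp only [hD, Set.mem_ofPred_eq, not_forall, not_frequently, not_lt] at hx
  obtain ⟨k, hk⟩ := hx
  refine lt_of_lt_of_le (by positivity : (0 : ℝ) < 1 / (k + 1))
    (le_liminf_of_le (isCoboundedUnder_ge_density _) ?_)
  -- The density up to `N` counts the `N + 1` times `0, …, N`.
  filter_upwards [(tendsto_add_atTop_nat 1).eventually hk] with N hN
  rw [birkhoffSum_indicator_eq_ncard, div_le_div_iff₀ (by positivity) (by positivity), one_mul]
  exact_mod_cast hN

/-- A strictly invariant measurable set is its own preimage under every iterate, hence lies in the
tail sigma-algebra. -/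
lemma IsExactMeasure.ergodic (h : IsExactMeasure f μ) : Ergodic f μ where
  toMeasurePreserving := h.measurePreserving
  aeconst_set s hs hfs := by
    have := h.isProbabilityMeasure
    rw [eventuallyConst_set']
    rcases h.zero_or_one s fun n => ⟨s, hs, by
      rw [Set.preimage_iterate_eq]; exact Function.IsFixedPt.iterate hfs n⟩ with h0 | h1
    · exact Or.inl (ae_eq_empty.2 h0)
    · exact Or.inr ((ae_eq_univ_iff_measure_eq hs.nullMeasurableSet).2 (by simp [h1]))

/-- Almost every point is frequently hypercyclic for an exact measure of full support. -/
lemma IsExactMeasure.ae_isFrequentlyHypercyclicVector [TopologicalSpace α]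
    [SecondCountableTopology α] [OpensMeasurableSpace α] (h : IsExactMeasure f μ)
    [μ.IsOpenPosMeasure] : ∀ᵐ x ∂μ, IsFrequentlyHypercyclicVector f x := by
  have := h.isProbabilityMeasure
  have hb : ∀ᵐ x ∂μ, ∀ V ∈ countableBasis α, 0 < lowerDensity {n : ℕ | f^[n] x ∈ V} := by
    rw [ae_ball_iff (countable_countableBasis α)]
    intro V hV
    exact h.ergodic.ae_lowerDensity_pos (isOpen_of_mem_countableBasis hV).measurableSet
      ((isOpen_of_mem_countableBasis hV).measure_pos μ (nonempty_of_mem_countableBasis hV))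
  filter_upwards [hb] with x hx V hV ⟨y, hy⟩
  obtain ⟨W, hW, -, hWV⟩ := (isBasis_countableBasis α).exists_subset_of_mem_open hy hV
  exact (hx W hW).trans_le (lowerDensity_mono fun n hn => hWV hn)

end Ergodic

/-! ### Sequences of linear growth and the intertwining map -/

/-- The sequences of at most linear growth. -/
def linearGrowth : Set (ℕ → ℂ) := {x | ∃ C : ℕ, ∀ᶠ n : ℕ in atTop, ‖x n‖ ≤ C * (n + 1)}

lemma measurableSet_linearGrowth : MeasurableSet linearGrowth := by
  have : linearGrowth =
      ⋃ C : ℕ, ⋃ m : ℕ, ⋂ n : ℕ, ⋂ (_ : m ≤ n), {x : ℕ → ℂ | ‖x n‖ ≤ C * (n + 1)} := by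
    ext x; simp [linearGrowth]
  rw [this]
  exact .iUnion fun C => .iUnion fun m => .iInter fun n => .iInter fun _ =>
    measurableSet_le (by fun_prop) measurable_const

lemma exists_bound_of_mem_linearGrowth {x : ℕ → ℂ} (h : x ∈ linearGrowth) :
    ∃ C : ℝ, ∀ n : ℕ, ‖x n‖ ≤ C * (n + 1) := by
  obtain ⟨C, hC⟩ := h
  obtain ⟨m, hm⟩ := eventually_atTop.1 hC
  obtain ⟨B, hB⟩ := ((Finset.range m).image fun n => ‖x n‖).exists_le
  refine ⟨max C B, fun n => ?_⟩
  by_cases hmn : n < m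
  · have h1 := hB _ (Finset.mem_image_of_mem _ (Finset.mem_range.2 hmn))
    have h2 : 0 ≤ max (C : ℝ) B := C.cast_nonneg.trans (le_max_left _ _)
    calc ‖x n‖ ≤ max (C : ℝ) B := h1.trans (le_max_right _ _)
      _ ≤ max (C : ℝ) B * (n + 1) := le_mul_of_one_le_right h2 (by simp)
  · exact (hm n (by omega)).trans (by gcongr; exact le_max_left _ _)

lemma mem_linearGrowth_congr {x y : ℕ → ℂ} (h : x =ᶠ[atTop] y) :
    x ∈ linearGrowth ↔ y ∈ linearGrowth := by
  refine exists_congr fun C => eventually_congr ?_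
  filter_upwards [h] with n hn
  rw [hn]

lemma shift_mem_linearGrowth {x : ℕ → ℂ} (k : ℕ) :
    (fun n => x (n + k)) ∈ linearGrowth ↔ x ∈ linearGrowth := by
  constructor
  · rintro ⟨C, hC⟩
    refine ⟨C, ?_⟩
    obtain ⟨m, hm⟩ := eventually_atTop.1 hC
    filter_upwards [eventually_ge_atTop (m + k)] with n hn
    obtain ⟨j, rfl⟩ : ∃ j, n = j + k := ⟨n - k, by omega⟩
    refine (hm j (by omega)).trans ?_
    gcongr
    omega
  · rintro ⟨C, hC⟩
    refine ⟨C * (k + 1), ?_⟩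
    filter_upwards [(tendsto_add_atTop_nat k).eventually hC] with n hn
    refine hn.trans ?_
    push_cast
    rw [mul_assoc]
    gcongr
    nlinarith [mul_nonneg (k.cast_nonneg : (0 : ℝ) ≤ k) (n.cast_nonneg : (0 : ℝ) ≤ n)]

/-- The sum of the series `∑ (x n / β n) z ^ n` in `H(U)` for the sequences `x` of linear growth,
and zero for the other ones. -/
noncomputable def coeffSeries (U : Opens ℂ) (w : ℕ → ℂ) (x : ℕ → ℂ) : HolSpace U :=
  ∑' n, (linearGrowth.indicator id x n / weightProd w n) • HolSpace.monomial U n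

section CoeffSeries

open HolSpace

variable {U : Opens ℂ} {T : HolSpace U →L[ℂ] HolSpace U} {w : ℕ → ℂ}

lemma indicator_linearGrowth_mem (x : ℕ → ℂ) : linearGrowth.indicator id x ∈ linearGrowth := by
  by_cases hx : x ∈ linearGrowth
  · simp [hx]
  · rw [Set.indicator_of_notMem hx]
    exact ⟨0, by simp⟩

lemma hasSum_coeffSeries (hT : IsWeightedShift T w) (hD : DiscExhausted U) (h0 : (0 : ℂ) ∈ U)
    (hchaos : IsChaotic T) (x : ℕ → ℂ) :
    HasSum (fun n => (linearGrowth.indicator id x n / weightProd w n) • monomial U n)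
      (coeffSeries U w x) := by
  obtain ⟨C, hC⟩ := exists_bound_of_mem_linearGrowth (indicator_linearGrowth_mem x)
  exact (hT.summable_of_linear_growth hD h0 hchaos hC).hasSum

lemma measurable_indicator_linearGrowth :
    Measurable (linearGrowth.indicator (id : (ℕ → ℂ) → ℕ → ℂ)) :=
  measurable_id.indicator measurableSet_linearGrowth

lemma measurable_coeffSeries (hT : IsWeightedShift T w) (hD : DiscExhausted U) (h0 : (0 : ℂ) ∈ U)
    (hchaos : IsChaotic T) : Measurable (coeffSeries U w) := by
  refine measurable_of_tendsto_metrizable (f := fun (N : ℕ) (x : ℕ → ℂ) =>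
    ∑ n ∈ Finset.range N, (linearGrowth.indicator id x n / weightProd w n) • monomial U n)
    (fun N => ?_) (tendsto_pi_nhds.2 fun x =>
      (hasSum_coeffSeries hT hD h0 hchaos x).tendsto_sum_nat)
  have hc : Continuous fun x : ℕ → ℂ =>
      ∑ n ∈ Finset.range N, (x n / weightProd w n) • monomial U n := by fun_prop
  exact hc.measurable.comp measurable_indicator_linearGrowth

/-- Linear growth holds for a sequence exactly when it holds for its shifts, so the truncation in
`coeffSeries` commutes with the shift. The identity therefore holds everywhere, which lets tail sets
be pulled back exactly rather than up to null sets. -/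
lemma iterate_coeffSeries (hT : IsWeightedShift T w) (hD : DiscExhausted U) (h0 : (0 : ℂ) ∈ U)
    (hchaos : IsChaotic T) (k : ℕ) (x : ℕ → ℂ) :
    T^[k] (coeffSeries U w x) = coeffSeries U w fun n => x (n + k) := by
  refine (hT.hasSum_iterate (hasSum_coeffSeries hT hD h0 hchaos x) k).unique ?_
  convert hasSum_coeffSeries hT hD h0 hchaos fun n => x (n + k) using 4 with n
  by_cases hx : x ∈ linearGrowth
  · rw [Set.indicator_of_mem hx, Set.indicator_of_mem ((shift_mem_linearGrowth k).2 hx)]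
    rfl
  · rw [Set.indicator_of_notMem hx, Set.indicator_of_notMem (mt (shift_mem_linearGrowth k).1 hx)]
    rfl

/-- A finite number of coefficients may be split off. -/
lemma coeffSeries_eq_sum_add (hT : IsWeightedShift T w) (hD : DiscExhausted U)
    (h0 : (0 : ℂ) ∈ U) (hchaos : IsChaotic T) {x : ℕ → ℂ} (hx : x ∈ linearGrowth) (m : ℕ) :
    coeffSeries U w x = ∑ n ∈ Finset.range m, (x n / weightProd w n) • monomial U n +
      coeffSeries U w fun n => if n < m then 0 else x n := by
  set y : ℕ → ℂ := fun n => if n < m then 0 else x n with hy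
  have hyG : y ∈ linearGrowth := by
    refine (mem_linearGrowth_congr ?_).2 hx
    filter_upwards [eventually_ge_atTop m] with n hn
    simp [hy, hn.not_gt]
  have h1 := hasSum_coeffSeries hT hD h0 hchaos x
  have h2 := hasSum_coeffSeries hT hD h0 hchaos y
  rw [Set.indicator_of_mem hx, id] at h1
  rw [Set.indicator_of_mem hyG, id] at h2
  have h3 : HasSum (fun n => ((if n < m then x n else 0) / weightProd w n) • monomial U n)
      (∑ n ∈ Finset.range m, (x n / weightProd w n) • monomial U n) := by
    have h4 := hasSum_sum_of_ne_finset_zero (s := Finset.range m)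
      (f := fun n => ((if n < m then x n else 0) / weightProd w n) • monomial U n)
      (L := .unconditional ℕ) (fun n hn => by
        rw [if_neg (by simpa using hn)]; simp)
    convert h4 using 1
    exact Finset.sum_congr rfl fun n hn => by rw [if_pos (Finset.mem_range.1 hn)]
  refine h1.unique ((h3.add h2).congr_fun fun n => ?_)
  by_cases hn : n < m <;> simp [hy, hn]

end CoeffSeries

/-! ### The Bernoulli shift -/

section Sequences

variable (ν : Measure ℂ) [IsProbabilityMeasure ν]

/-- The sigma-algebra of the `i`-th coordinate. -/
noncomputable abbrev coordSigma (i : ℕ) : MeasurableSpace (ℕ → ℂ) :=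
  MeasurableSpace.comap (fun x => x i) inferInstance

lemma coordSigma_le (i : ℕ) : coordSigma i ≤ (inferInstance : MeasurableSpace (ℕ → ℂ)) :=
  (measurable_pi_apply i).comap_le

lemma iIndep_coordSigma : iIndep coordSigma (Measure.infinitePi fun _ : ℕ => ν) :=
  iIndepFun.iIndep (iIndepFun_infinitePi (P := fun _ : ℕ => ν) (X := fun _ z => z)
    fun _ => measurable_id)

lemma measurable_apply_of_mem {S : Set ℕ} {i : ℕ} (hi : i ∈ S) :
    Measurable[⨆ j ∈ S, coordSigma j] fun x : ℕ → ℂ => x i :=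
  (comap_measurable (fun x : ℕ → ℂ => x i)).mono (le_iSup₂_of_le i hi le_rfl) le_rfl

/-- Measurability with respect to the coordinates from `k` on is what places a set that is a
preimage under all shifts in the tail sigma-algebra. -/
lemma measurable_shift (k : ℕ) :
    Measurable[⨆ j ∈ Set.Ici k, coordSigma j] fun (x : ℕ → ℂ) n => x (n + k) := by
  refine @measurable_pi_lambda _ _ _ (_) _ _ fun n => measurable_apply_of_mem ?_
  simp

lemma measurePreserving_shift (k : ℕ) :
    MeasurePreserving (fun (x : ℕ → ℂ) n => x (n + k)) (Measure.infinitePi fun _ : ℕ => ν)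
      (Measure.infinitePi fun _ : ℕ => ν) :=
  ⟨by fun_prop, Measure.map_infinitePi_infinitePi_of_inj (P := fun _ : ℕ => ν)
    (add_left_injective k)⟩

/-- **Kolmogorov's zero-one law** for the shift on sequences. -/
lemma measure_zero_or_one_of_shift {A : Set (ℕ → ℂ)}
    (hA : ∀ k : ℕ, ∃ B : Set (ℕ → ℂ), MeasurableSet B ∧
      (fun (x : ℕ → ℂ) n => x (n + k)) ⁻¹' B = A) :
    Measure.infinitePi (fun _ : ℕ => ν) A = 0 ∨ Measure.infinitePi (fun _ : ℕ => ν) A = 1 := by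
  refine measure_zero_or_one_of_measurableSet_limsup_atTop coordSigma_le (iIndep_coordSigma ν) ?_
  rw [limsup_eq_iInf_iSup_of_nat, MeasurableSpace.measurableSet_iInf]
  intro k
  obtain ⟨B, hB, rfl⟩ := hA k
  exact measurable_shift k hB

/-- Under a summability condition on the tails of `ν`, almost every sequence has at most linear
growth. -/
lemma ae_mem_linearGrowth (hν : ∑' n : ℕ, ν {z | (n : ℝ) < ‖z‖} ≠ ⊤) :
    ∀ᵐ x ∂Measure.infinitePi (fun _ : ℕ => ν), x ∈ linearGrowth := by
  have h : ∀ n : ℕ, Measure.infinitePi (fun _ : ℕ => ν) {x | (n : ℝ) < ‖x n‖} =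
      ν {z | (n : ℝ) < ‖z‖} := fun n =>
    (measurePreserving_eval_infinitePi (fun _ : ℕ => ν) n).measure_preimage
      (measurableSet_lt measurable_const measurable_norm).nullMeasurableSet
  simp_rw [← h] at hν
  filter_upwards [ae_eventually_notMem hν] with x hx
  refine ⟨1, hx.mono fun n hn => ?_⟩
  have : ‖x n‖ ≤ n := not_lt.1 hn
  push_cast
  linarith

/-- Independence of the coordinates below `m` from those at or above `m`. The head is zeroed rather
than dropped, so that the tail event concerns the actual remainder of the series. -/
lemma measure_inter_box_tail {m : ℕ} {O : ℕ → Set ℂ} (hO : ∀ n, MeasurableSet (O n))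
    {B : Set (ℕ → ℂ)} (hB : MeasurableSet B) :
    Measure.infinitePi (fun _ : ℕ => ν) ({x | ∀ n < m, x n ∈ O n} ∩
      (fun (x : ℕ → ℂ) n => if n < m then 0 else x n) ⁻¹' B) =
    (∏ n ∈ Finset.range m, ν (O n)) * Measure.infinitePi (fun _ : ℕ => ν)
      ((fun (x : ℕ → ℂ) n => if n < m then 0 else x n) ⁻¹' B) := by
  have hbox : {x : ℕ → ℂ | ∀ n < m, x n ∈ O n} = Set.pi (Finset.range m) O := by
    ext x; simp [Set.mem_pi]
  rw [← Measure.infinitePi_pi (μ := fun _ : ℕ => ν) (s := Finset.range m) (t := O)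
    fun n _ => hO n, ← hbox]
  refine (Indep_iff _ _ _).1 (indep_iSup_of_disjoint coordSigma_le (iIndep_coordSigma ν)
    (S := Set.Iio m) (T := Set.Ici m) ?_) _ _ ?_ ?_
  · exact Set.disjoint_left.2 fun n (h1 : n < m) (h2 : m ≤ n) => h1.not_ge h2
  · have : {x : ℕ → ℂ | ∀ n < m, x n ∈ O n} = ⋂ n, ⋂ (_ : n < m), (fun x => x n) ⁻¹' O n := by
      ext x; simp
    rw [this]
    refine @MeasurableSet.iInter _ _ (_) _ _ fun n => @MeasurableSet.iInter _ _ (_) _ _ fun hn =>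
      measurable_apply_of_mem (S := Set.Iio m) hn (hO n)
  · refine (@measurable_pi_lambda _ _ _ (_) _ _ fun n => ?_) hB
    by_cases hn : n < m
    · simp only [hn, if_true]
      exact @measurable_const _ _ _ (_) _
    · simp only [hn, if_false]
      exact measurable_apply_of_mem (S := Set.Ici m) (not_lt.1 hn)

end Sequences

/-! ### The law of the random series -/

section Law

open HolSpace

variable {U : Opens ℂ} {T : HolSpace U →L[ℂ] HolSpace U} {w : ℕ → ℂ}
  (ν : Measure ℂ) [IsProbabilityMeasure ν]

/-- The law of the random series is an exact measure for the shift. -/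
lemma isExactMeasure_map_coeffSeries (hT : IsWeightedShift T w) (hD : DiscExhausted U)
    (h0 : (0 : ℂ) ∈ U) (hchaos : IsChaotic T) :
    IsExactMeasure T ((Measure.infinitePi fun _ : ℕ => ν).map (coeffSeries U w)) := by
  have hm := measurable_coeffSeries hT hD h0 hchaos
  refine ⟨Measure.isProbabilityMeasure_map hm.aemeasurable, ⟨T.continuous.measurable, ?_⟩,
    fun A hA => ?_⟩
  · rw [Measure.map_map T.continuous.measurable hm]
    have : T ∘ coeffSeries U w = coeffSeries U w ∘ fun (x : ℕ → ℂ) n => x (n + 1) :=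
      funext fun x => iterate_coeffSeries hT hD h0 hchaos 1 x
    rw [this, ← Measure.map_map hm (measurePreserving_shift ν 1).measurable,
      (measurePreserving_shift ν 1).map_eq]
  · have hAm : MeasurableSet A := by
      obtain ⟨B, hB, rfl⟩ := hA 0
      simpa using hB
    rw [Measure.map_apply hm hAm]
    refine measure_zero_or_one_of_shift ν fun k => ?_
    obtain ⟨B, hB, rfl⟩ := hA k
    refine ⟨coeffSeries U w ⁻¹' B, hm hB, ?_⟩
    ext x
    simp only [Set.mem_preimage, iterate_coeffSeries hT hD h0 hchaos]

/-- The law of the random series has full support. -/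
lemma isOpenPosMeasure_map_coeffSeries (hT : IsWeightedShift T w) (hD : DiscExhausted U)
    (h0 : (0 : ℂ) ∈ U) (hchaos : IsChaotic T) (hν : ∑' n : ℕ, ν {z | (n : ℝ) < ‖z‖} ≠ ⊤)
    [ν.IsOpenPosMeasure] :
    ((Measure.infinitePi fun _ : ℕ => ν).map (coeffSeries U w)).IsOpenPosMeasure := by
  refine ⟨fun V hV ⟨f, hf⟩ => ?_⟩
  have hm := measurable_coeffSeries hT hD h0 hchaos
  set Q := Measure.infinitePi fun _ : ℕ => ν
  set Z : ℕ → (ℕ → ℂ) → ℕ → ℂ := fun m x n => if n < m then 0 else x n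
  rw [Measure.map_apply hm hV.measurableSet]
  -- a polynomial in `V`
  obtain ⟨c, hc, -⟩ := exists_taylor hD h0 f
  obtain ⟨m₀, hm₀⟩ : ∃ m₀, ∑ n ∈ Finset.range m₀, c n • monomial U n ∈ V :=
    (hc.tendsto_sum_nat.eventually (hV.mem_nhds hf)).exists
  set a : ℕ → ℂ := fun n => if n < m₀ then c n * weightProd w n else 0 with ha
  set p : HolSpace U := ∑ n ∈ Finset.range m₀, c n • monomial U n with hp
  have hadd : Tendsto (fun q : HolSpace U × HolSpace U => q.1 + q.2) (𝓝 p ×ˢ 𝓝 0) (𝓝 p) := by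
    have := (continuous_add (M := HolSpace U)).tendsto (p, 0)
    rwa [nhds_prod_eq, add_zero] at this
  obtain ⟨O, hO, W, hW, hOW⟩ := mem_prod_iff.1 (hadd (hV.mem_nhds hm₀))
  obtain ⟨W', hW'W, hW'o, hW'0⟩ := mem_nhds_iff.1 hW
  -- tails
  have htail : ∀ x ∈ linearGrowth, Tendsto (fun m => coeffSeries U w (Z m x)) atTop (𝓝 0) := by
    intro x hx
    have h1 := (hasSum_coeffSeries hT hD h0 hchaos x).tendsto_sum_nat
    rw [Set.indicator_of_mem hx, id] at h1
    have h2 := tendsto_const_nhds (x := coeffSeries U w x) |>.sub h1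
    rw [show coeffSeries U w x - coeffSeries U w x = 0 from sub_self (G := HolSpace U) _] at h2
    exact h2.congr fun m => (sub_eq_iff_eq_add' (G := HolSpace U)).2 (coeffSeries_eq_sum_add hT hD h0 hchaos hx m)
  -- Almost every remainder is eventually in `W'`, so these countably many events cover almost
  -- everything and one is not null. Cutting at or after `m₀` keeps the whole polynomial in the
  -- head.
  obtain ⟨k, hk⟩ : ∃ k, 0 < Q (Z (m₀ + k) ⁻¹' (coeffSeries U w ⁻¹' W')) := by
    refine exists_measure_pos_of_not_measure_iUnion_null ?_
    have : ∀ᵐ x ∂Q, x ∈ ⋃ k, Z (m₀ + k) ⁻¹' (coeffSeries U w ⁻¹' W') := by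
      filter_upwards [ae_mem_linearGrowth ν hν] with x hx
      obtain ⟨N, hN⟩ := eventually_atTop.1 ((htail x hx).eventually (hW'o.mem_nhds hW'0))
      exact Set.mem_iUnion.2 ⟨N, hN _ (by omega)⟩
    intro h0'
    obtain ⟨x, hx1, hx2⟩ := (this.and (measure_eq_zero_iff_ae_notMem.1 h0')).exists
    exact hx2 hx1
  set m := m₀ + k with hmdef
  -- the head
  have hhead : Continuous fun x : ℕ → ℂ =>
      ∑ n ∈ Finset.range m, (x n / weightProd w n) • monomial U n := by fun_prop
  have hheada : ∑ n ∈ Finset.range m, (a n / weightProd w n) • monomial U n = p := by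
    rw [hmdef, Finset.sum_range_add, hp]
    rw [Finset.sum_eq_zero (s := Finset.range k) fun n _ => by simp [ha], add_zero]
    refine Finset.sum_congr rfl fun n hn => ?_
    rw [ha]
    simp only [Finset.mem_range.1 hn, if_true]
    rw [mul_div_cancel_right₀ _ (hT.weightProd_ne_zero n)]
  have hpre : (fun x : ℕ → ℂ => ∑ n ∈ Finset.range m, (x n / weightProd w n) • monomial U n) ⁻¹'
      O ∈ 𝓝 a := hhead.continuousAt (by rw [hheada]; exact hO)
  rw [nhds_pi, mem_pi'] at hpre
  obtain ⟨I, t, ht, hIt⟩ := hpre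
  set B : ℕ → Set ℂ := fun n => interior (t n) with hB
  have hbox : ∀ x : ℕ → ℂ, (∀ n < m, x n ∈ B n) →
      ∑ n ∈ Finset.range m, (x n / weightProd w n) • monomial U n ∈ O := by
    intro x hx
    -- The index set `I` may contain coordinates beyond the head; they are filled in with `a`, which
    -- the head sum does not see.
    have hmem : (fun n => if n < m then x n else a n) ∈ (I : Set ℕ).pi t := by
      intro n _
      by_cases hn : n < m
      · simpa only [hn, if_true] using interior_subset (hx n hn)
      · simpa only [hn, if_false] using mem_of_mem_nhds (ht n)
    have := hIt hmem
    rw [Set.mem_preimage] at this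
    convert this using 1
    exact Finset.sum_congr rfl fun n hn => by simp only [Finset.mem_range.1 hn, if_true]
  intro hnull
  have hz := measure_inter_box_tail ν (m := m) (O := B) (fun n => isOpen_interior.measurableSet)
    (hm hW'o.measurableSet)
  -- Head in `O` and remainder in `W` put the sum in `V`. The splitting needs linear growth, hence
  -- holds only almost everywhere.
  have hz0 : Q ({x | ∀ n < m, x n ∈ B n} ∩ Z m ⁻¹' (coeffSeries U w ⁻¹' W')) = 0 := by
    rw [measure_eq_zero_iff_ae_notMem]
    filter_upwards [ae_mem_linearGrowth ν hν, measure_eq_zero_iff_ae_notMem.1 hnull]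
      with x hx hxV hxB
    refine hxV ?_
    rw [Set.mem_preimage, coeffSeries_eq_sum_add hT hD h0 hchaos hx m]
    exact hOW (Set.mk_mem_prod (hbox x hxB.1) (hW'W hxB.2))
  rw [hz0] at hz
  refine (mul_ne_zero (Finset.prod_ne_zero_iff.2 fun n _ => ?_) hk.ne') hz.symm
  exact isOpen_interior.measure_ne_zero ν ⟨a n, mem_interior_iff_mem_nhds.2 (ht n)⟩

end Law

/-! ### Tails and supports of the admissible variables -/

section Laws

lemma isOpenPosMeasure_gaussianReal (m : ℝ) {v : NNReal} (hv : v ≠ 0) :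
    (gaussianReal m v).IsOpenPosMeasure :=
  (gaussianReal_absolutelyContinuous' m hv).isOpenPosMeasure

/-- A Gaussian measure on `ℂ` for which no nonzero real linear functional is almost surely
constant has full support. -/
lemma isOpenPosMeasure_of_isGaussian (ν : Measure ℂ) [IsGaussian ν]
    (h : ∀ L : ℂ →L[ℝ] ℝ, L ≠ 0 → ¬ ∃ c : ℝ, ∀ᵐ z ∂ν, L z = c) : ν.IsOpenPosMeasure := by
  have hid : HasGaussianLaw (id : ℂ → ℂ) ν := IsGaussian.hasGaussianLaw_id
  have hvar : ∀ L : ℂ →L[ℝ] ℝ, L ≠ 0 → 0 < Var[L; ν] := by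
    intro L hL
    refine (variance_nonneg _ _).lt_of_ne' fun h0 => h L hL ⟨ν[L], ?_⟩
    exact ae_eq_integral_of_variance_eq_zero (hid.map L).memLp_two h0
  have hmap : ∀ L : ℂ →L[ℝ] ℝ, L ≠ 0 → (ν.map L).IsOpenPosMeasure := by
    intro L hL
    have := (hid.map L).map_eq_gaussianReal
    rw [Function.comp_id] at this
    rw [this]
    exact isOpenPosMeasure_gaussianReal _ (by simpa using hvar L hL)
  -- The regression coefficient: `Im - t * Re` is uncorrelated with `Re`, hence independent of it by
  -- joint normality. In these linear coordinates `ν` is a product of two nondegenerate real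
  -- Gaussians.
  set t : ℝ := cov[Complex.reCLM, Complex.imCLM; ν] / Var[Complex.reCLM; ν] with ht
  set L : ℂ →L[ℝ] ℝ := Complex.imCLM - t • Complex.reCLM with hL
  have hre : Complex.reCLM ≠ 0 := fun h => by simpa using congrArg (fun L => L (1 : ℂ)) h
  have hL0 : L ≠ 0 := fun h => by simpa [hL] using congrArg (fun L => L Complex.I) h
  have hcov : cov[Complex.reCLM, L; ν] = 0 := by
    have hLf : (L : ℂ → ℝ) = (Complex.imCLM : ℂ → ℝ) - t • (Complex.reCLM : ℂ → ℝ) := rfl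
    have h1 : MemLp Complex.reCLM 2 ν := (hid.map Complex.reCLM).memLp_two
    have h2 : MemLp Complex.imCLM 2 ν := (hid.map Complex.imCLM).memLp_two
    rw [hLf, covariance_sub_right h1 h2 (h1.const_smul t), covariance_smul_right,
      covariance_self h1.aemeasurable, ht, div_mul_cancel₀ _ (hvar _ hre).ne', sub_self]
  have hind : IndepFun Complex.reCLM L ν :=
    (hid.map (Complex.reCLM.prod L)).indepFun_of_covariance_eq_zero hcov
  have hprod := (indepFun_iff_map_prod_eq_prod_map_map (by fun_prop) (by fun_prop)).1 hind
  have := hmap _ hre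
  have := hmap _ hL0
  have hp : (ν.map fun z => (Complex.reCLM z, L z)).IsOpenPosMeasure := by
    rw [hprod]; infer_instance
  set Φ : ℝ × ℝ → ℂ := fun q => q.1 + (q.2 + t * q.1) * Complex.I with hΦ
  have hΦc : Continuous Φ := by fun_prop
  have hΦinv : Φ ∘ (fun z => (Complex.reCLM z, L z)) = id := by
    funext z
    apply Complex.ext <;> simp [hΦ, hL]
  have : ν = (ν.map fun z => (Complex.reCLM z, L z)).map Φ := by
    rw [Measure.map_map hΦc.measurable (by fun_prop), hΦinv, Measure.map_id]
  rw [this]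
  exact hΦc.isOpenPosMeasure_map fun z => ⟨_, congrFun hΦinv z⟩

lemma tsum_measure_lt_norm_ne_top (ν : Measure ℂ) [IsProbabilityMeasure ν]
    (hν : Integrable id ν) : ∑' n : ℕ, ν {z | (n : ℝ) < ‖z‖} ≠ ⊤ := by
  -- `tsum_prob_mem_Ioi_lt_top` is stated for `volume`, so `ν` is installed in that role.
  let _ : MeasureSpace ℂ := ⟨ν⟩
  have : IsProbabilityMeasure (volume : Measure ℂ) := ‹IsProbabilityMeasure ν›
  exact (tsum_prob_mem_Ioi_lt_top (X := fun z : ℂ => ‖z‖) hν.norm fun z => norm_nonneg z).ne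

variable {Ω : Type*} [MeasurableSpace Ω] {P : Measure Ω} [IsProbabilityMeasure P] {X : Ω → ℂ}

lemma IsSubgaussian.tsum_measure_lt_norm_ne_top (h : IsSubgaussian P X) :
    ∑' n : ℕ, P {ω | (n : ℝ) < ‖X ω‖} ≠ ⊤ := by
  obtain ⟨C, c, hC, hc, h⟩ := h
  have hle : ∀ n : ℕ, P {ω | (n : ℝ) < ‖X ω‖} ≤ ENNReal.ofReal (C * Real.exp (-c) ^ n) := by
    intro n
    have hsub : {ω | (n : ℝ) < ‖X ω‖} ⊆ {ω | (n : ℝ) ≤ ‖X ω‖} := fun ω hω =>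
      le_of_lt (show (n : ℝ) < ‖X ω‖ from hω)
    rw [← ofReal_measureReal]
    refine ENNReal.ofReal_le_ofReal
      ((measureReal_mono hsub).trans ((h n n.cast_nonneg).trans ?_))
    rw [← Real.exp_nat_mul]
    refine mul_le_mul_of_nonneg_left (Real.exp_le_exp.2 ?_) hC.le
    -- This weakens the tail bound to a geometric one.
    have : (n : ℝ) ≤ (n : ℝ) ^ 2 := by exact_mod_cast Nat.le_self_pow two_ne_zero n
    nlinarith
  refine ne_top_of_le_ne_top ?_ (ENNReal.tsum_le_tsum hle)
  refine Summable.tsum_ofReal_ne_top (Summable.mul_left C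
    (summable_geometric_of_lt_one (Real.exp_pos _).le ?_))
  simpa using hc

lemma tsum_map_lt_norm_ne_top_and_isOpenPosMeasure (hX : AEMeasurable X P)
    (h : (IsSubgaussian P X ∧ HasFullSupport P X) ∨ IsNondegenerateGaussian P X) :
    ∑' n : ℕ, P.map X {z | (n : ℝ) < ‖z‖} ≠ ⊤ ∧ (P.map X).IsOpenPosMeasure := by
  rcases h with ⟨h1, h2⟩ | ⟨h1, h2⟩
  · refine ⟨?_, h2⟩
    convert h1.tsum_measure_lt_norm_ne_top using 4 with n
    exact Measure.map_apply_of_aemeasurable hX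
      (measurableSet_lt measurable_const measurable_norm)
  · refine ⟨tsum_measure_lt_norm_ne_top _ (IsGaussian.integrable_id), ?_⟩
    refine isOpenPosMeasure_of_isGaussian _ fun L hL ⟨c, hc⟩ => h2 L hL ⟨c, ae_of_ae_map hX hc⟩

end Laws

/-! ### Transfer from the product space to the given variables -/

theorem mainTheorem4
    (U : Opens ℂ)
    (hU : (U : Set ℂ) = Set.univ ∨ ∃ R : ℝ, 0 < R ∧ (U : Set ℂ) = Metric.ball 0 R)
    (T : HolSpace U →L[ℂ] HolSpace U) (w : ℕ → ℂ)
    (hT : IsWeightedShift T w) (hchaos : IsChaotic T)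
    {Ω₀ : Type*} [MeasurableSpace Ω₀] (P₀ : Measure Ω₀) [IsProbabilityMeasure P₀]
    (X₀ : Ω₀ → ℂ)
    (hX₀ : (IsSubgaussian P₀ X₀ ∧ HasFullSupport P₀ X₀) ∨ IsNondegenerateGaussian P₀ X₀)
    {Ω : Type*} [MeasurableSpace Ω] (P : Measure Ω) [IsProbabilityMeasure P]
    (X : ℕ → Ω → ℂ) (hindep : iIndepFun X P)
    (hident : ∀ n, IdentDistrib (X n) X₀ P P₀) :
    (∀ᵐ ω ∂P, Summable fun n : ℕ => (X n ω / weightProd w n) • HolSpace.monomial U n) ∧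
    AEMeasurable (randomFunction U w X) P ∧
    (∀ᵐ ω ∂P, IsFrequentlyHypercyclicVector T (randomFunction U w X ω)) ∧
    IsExactMeasure T (P.map (randomFunction U w X)) ∧
    (P.map (randomFunction U w X)).IsOpenPosMeasure := by
  have hD := HolSpace.discExhausted_of_eq_univ_or_ball hU
  have h0 := HolSpace.zero_mem_of_eq_univ_or_ball hU
  have hX₀m : AEMeasurable X₀ P₀ := (hident 0).aemeasurable_snd
  obtain ⟨hν, hpos⟩ := tsum_map_lt_norm_ne_top_and_isOpenPosMeasure hX₀m hX₀
  set ν := P₀.map X₀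
  have : IsProbabilityMeasure ν := Measure.isProbabilityMeasure_map hX₀m
  have hm := measurable_coeffSeries hT hD h0 hchaos
  have hXm : AEMeasurable (fun ω n => X n ω) P :=
    aemeasurable_pi_iff.2 fun n => (hident n).aemeasurable_fst
  have hlaw : P.map (fun ω n => X n ω) = Measure.infinitePi fun _ : ℕ => ν := by
    rw [hindep.map_fun_eq_infinitePi_map₀ hXm]
    simp_rw [fun n => (hident n).map_eq]
    rfl
  have hgrowth : ∀ᵐ ω ∂P, (fun n => X n ω) ∈ linearGrowth := by
    have := ae_mem_linearGrowth ν hν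
    rw [← hlaw] at this
    exact ae_of_ae_map hXm this
  have hsum : ∀ᵐ ω ∂P, HasSum (fun n => (X n ω / weightProd w n) • HolSpace.monomial U n)
      (coeffSeries U w fun n => X n ω) := by
    filter_upwards [hgrowth] with ω hω
    have := hasSum_coeffSeries hT hD h0 hchaos fun n => X n ω
    rwa [Set.indicator_of_mem hω] at this
  -- Off the event of linear growth the two sides may differ, so `randomFunction` is only shown to
  -- be measurable almost everywhere.
  have heq : randomFunction U w X =ᵐ[P] coeffSeries U w ∘ fun ω n => X n ω := by
    filter_upwards [hsum] with ω hω
    exact hω.tsum_eq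
  have hvm : AEMeasurable (randomFunction U w X) P := (hm.comp_aemeasurable hXm).congr heq.symm
  have hmap : P.map (randomFunction U w X) =
      (Measure.infinitePi fun _ : ℕ => ν).map (coeffSeries U w) := by
    rw [Measure.map_congr heq, ← hlaw, AEMeasurable.map_map_of_aemeasurable hm.aemeasurable hXm]
  have hexact := isExactMeasure_map_coeffSeries ν hT hD h0 hchaos
  have hopen := isOpenPosMeasure_map_coeffSeries ν hT hD h0 hchaos hν
  rw [← hmap] at hexact hopen
  exact ⟨hsum.mono fun ω h => h.summable, hvm,
    ae_of_ae_map hvm hexact.ae_isFrequentlyHypercyclicVector, hexact, hopen⟩
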